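/- Let $(Q,g)$ be a smooth (non-empty) two-dimensional pseudo-Riemannian manifold and $(F,h)$ a smooth pseudo-Riemannian manifold of dimension $n\ge 2$, both of arbitrary signature; if $n\ge 3$, assume that $F$ is connected. Let $r$ be a smooth positive function on $Q$, and let $M=Q\times_r F$ be the warped product, with metric $\tilde g=g+r^2h$. Write $\mathrm{Ric}$ and $S$ for Ricci and scalar curvature, $\mathrm{Einst}_h=\mathrm{Ric}_h-\tfrac12 S_h\,h$, and $\Delta_g=\mathrm{tr}_g\nabla^2$, and let $$G_F=\mathrm{Einst}_h-\frac{r^2}{2}S_g\,h+(n-1)\Big[r\,\Delta_g r+\frac{n-2}{2}\langle dr,dr\rangle_g\Big]h$$ be the part of the Einstein tensor of $(M,\tilde g)$ that is tangent to $F$. Suppose that $G_F=\lambda h$ for some function $\lambda:M\to\mathbb R$. Then $\lambda$ is constant along $F$, i.e. $\lambda(q,y)=\lambda(q,y')$ for all $q\in Q$ and $y,y'\in F$. Moreover, if $n\ge 3$, then $(F,h)$ is Einstein, i.e. $\mathrm{Ric}_h=c\,h$ for some constant $c\in\mathbb R$. -/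

import Mathlib

open scoped Manifold ContDiff

noncomputable section

/-! ### Classical tensor calculus on open sets of `ℝⁿ`

Below `G u` is the matrix `(G_ij(u))` of components of a metric at the point `u`. -/

/-- The partial derivative `∂_k f` at `u`. -/
def partialD {n : ℕ} (k : Fin n) (f : EuclideanSpace ℝ (Fin n) → ℝ)
    (u : EuclideanSpace ℝ (Fin n)) : ℝ :=
  fderiv ℝ f u (EuclideanSpace.single k 1)

/-- The Christoffel symbol `Γ^k_{ij} = ½ G^{kl} (∂_i G_{jl} + ∂_j G_{il} - ∂_l G_{ij})` of the
Levi-Civita connection. -/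
def christoffel {n : ℕ} (G : EuclideanSpace ℝ (Fin n) → Matrix (Fin n) (Fin n) ℝ)
    (k i j : Fin n) (u : EuclideanSpace ℝ (Fin n)) : ℝ :=
  (1 / 2 : ℝ) * ∑ l, (G u)⁻¹ k l *
    (partialD i (fun w => G w j l) u + partialD j (fun w => G w i l) u
      - partialD l (fun w => G w i j) u)

/-- The Ricci tensor
`R_{ij} = ∂_k Γ^k_{ij} - ∂_j Γ^k_{ik} + Γ^k_{kl} Γ^l_{ij} - Γ^k_{jl} Γ^l_{ik}`
(round spheres have positive Ricci curvature). -/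
def coordRicci {n : ℕ} (G : EuclideanSpace ℝ (Fin n) → Matrix (Fin n) (Fin n) ℝ)
    (u : EuclideanSpace ℝ (Fin n)) : Matrix (Fin n) (Fin n) ℝ :=
  Matrix.of fun i j =>
    (∑ k, (partialD k (christoffel G k i j) u - partialD j (christoffel G k i k) u))
      + ∑ k, ∑ l, (christoffel G k k l u * christoffel G l i j u
          - christoffel G k j l u * christoffel G l i k u)

/-- The scalar curvature `S = G^{ij} R_{ij}`. -/
def coordScal {n : ℕ} (G : EuclideanSpace ℝ (Fin n) → Matrix (Fin n) (Fin n) ℝ)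
    (u : EuclideanSpace ℝ (Fin n)) : ℝ :=
  ∑ i, ∑ j, (G u)⁻¹ i j * coordRicci G u i j

/-- The Einstein tensor `R_{ij} - ½ S G_{ij}`. -/
def coordEinstein {n : ℕ} (G : EuclideanSpace ℝ (Fin n) → Matrix (Fin n) (Fin n) ℝ)
    (u : EuclideanSpace ℝ (Fin n)) : Matrix (Fin n) (Fin n) ℝ :=
  coordRicci G u - ((1 / 2 : ℝ) * coordScal G u) • G u

/-- The Hessian `∇²_{ij} f = ∂_i ∂_j f - Γ^k_{ij} ∂_k f`. -/
def coordHessian {n : ℕ} (G : EuclideanSpace ℝ (Fin n) → Matrix (Fin n) (Fin n) ℝ)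
    (f : EuclideanSpace ℝ (Fin n) → ℝ) (u : EuclideanSpace ℝ (Fin n)) :
    Matrix (Fin n) (Fin n) ℝ :=
  Matrix.of fun i j =>
    partialD i (partialD j f) u - ∑ k, christoffel G k i j u * partialD k f u

/-- The Laplace-Beltrami operator `Δ f = G^{ij} ∇²_{ij} f`. -/
def coordLaplacian {n : ℕ} (G : EuclideanSpace ℝ (Fin n) → Matrix (Fin n) (Fin n) ℝ)
    (f : EuclideanSpace ℝ (Fin n) → ℝ) (u : EuclideanSpace ℝ (Fin n)) : ℝ :=
  ∑ i, ∑ j, (G u)⁻¹ i j * coordHessian G f u i j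

/-- The squared length `⟨df, df⟩ = G^{ij} ∂_i f ∂_j f`. -/
def coordGradSq {n : ℕ} (G : EuclideanSpace ℝ (Fin n) → Matrix (Fin n) (Fin n) ℝ)
    (f : EuclideanSpace ℝ (Fin n) → ℝ) (u : EuclideanSpace ℝ (Fin n)) : ℝ :=
  ∑ i, ∑ j, (G u)⁻¹ i j * (partialD i f u * partialD j f u)

/-! ### Pseudo-Riemannian manifolds -/

/-- A smooth pseudo-Riemannian metric, of arbitrary signature, on an `n`-dimensional manifold:
a smooth section of symmetric nondegenerate bilinear forms on the tangent spaces. -/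
structure PseudoRiemMetric (n : ℕ) (M : Type*) [TopologicalSpace M]
    [ChartedSpace (EuclideanSpace ℝ (Fin n)) M] [IsManifold (𝓡 n) ∞ M] where
  toForm (x : M) : TangentSpace (𝓡 n) x →L[ℝ] TangentSpace (𝓡 n) x →L[ℝ] ℝ
  symm (x : M) (v w : TangentSpace (𝓡 n) x) : toForm x v w = toForm x w v
  nondegenerate (x : M) (v : TangentSpace (𝓡 n) x) (hv : ∀ w, toForm x v w = 0) : v = 0
  contMDiff : ContMDiff (𝓡 n)
    ((𝓡 n).prod 𝓘(ℝ, EuclideanSpace ℝ (Fin n) →L[ℝ] EuclideanSpace ℝ (Fin n) →L[ℝ] ℝ)) ∞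
    (fun x => Bundle.TotalSpace.mk'
      (EuclideanSpace ℝ (Fin n) →L[ℝ] EuclideanSpace ℝ (Fin n) →L[ℝ] ℝ)
      (E := fun x : M => TangentSpace (𝓡 n) x →L[ℝ] TangentSpace (𝓡 n) x →L[ℝ] ℝ) x (toForm x))

/-- `φ` is a chart of the maximal smooth atlas of the `n`-manifold `M`. -/
def IsSmoothChart {n : ℕ} {M : Type*} [TopologicalSpace M]
    [ChartedSpace (EuclideanSpace ℝ (Fin n)) M]
    (φ : OpenPartialHomeomorph M (EuclideanSpace ℝ (Fin n))) : Prop :=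
  φ ∈ IsManifold.maximalAtlas (𝓡 n) ∞ M

/-- The `i`-th coordinate vector field of the chart `φ`, at the point with coordinates `u`. -/
def coordVector {n : ℕ} {M : Type*} [TopologicalSpace M]
    [ChartedSpace (EuclideanSpace ℝ (Fin n)) M]
    (φ : OpenPartialHomeomorph M (EuclideanSpace ℝ (Fin n)))
    (i : Fin n) (u : EuclideanSpace ℝ (Fin n)) : TangentSpace (𝓡 n) (φ.symm u) :=
  mfderiv (𝓡 n) (𝓡 n) φ.symm u
    (show TangentSpace (𝓡 n) u from EuclideanSpace.single i (1 : ℝ))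

/-- The components `G_ij = g(∂_i, ∂_j)` of the metric in the chart `φ`, as functions of the
coordinates. -/
def PseudoRiemMetric.components {n : ℕ} {M : Type*} [TopologicalSpace M]
    [ChartedSpace (EuclideanSpace ℝ (Fin n)) M] [IsManifold (𝓡 n) ∞ M] (g : PseudoRiemMetric n M)
    (φ : OpenPartialHomeomorph M (EuclideanSpace ℝ (Fin n)))
    (u : EuclideanSpace ℝ (Fin n)) : Matrix (Fin n) (Fin n) ℝ :=
  Matrix.of fun i j => g.toForm (φ.symm u) (coordVector φ i u) (coordVector φ j u)

/-- `(M, g)` is Einstein: `Ric = c g` for a constant `c`, as an identity of tensors,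
i.e. of components in every smooth chart. -/
def PseudoRiemMetric.IsEinstein {n : ℕ} {M : Type*} [TopologicalSpace M]
    [ChartedSpace (EuclideanSpace ℝ (Fin n)) M] [IsManifold (𝓡 n) ∞ M]
    (g : PseudoRiemMetric n M) : Prop :=
  ∃ c : ℝ, ∀ φ : OpenPartialHomeomorph M (EuclideanSpace ℝ (Fin n)), IsSmoothChart φ →
    ∀ x ∈ φ.source, coordRicci (g.components φ) (φ x) = c • g.components φ (φ x)

/-! ### Warped products `Q ×_r F` -/

/-- Components, at the point `(q, y)` of `Q × F`, of the fiber part of the Einstein tensor of the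
warped product metric `g + r² h`,
`G_F = Einst_h - (r² / 2) S_g h + (n - 1) (r Δ_g r + ((n - 2) / 2) ⟨dr, dr⟩_g) h`,
computed in a chart `ψ` of `Q` around `q` and a chart `φ` of `F` around `y`. -/
def warpedGF {n : ℕ} {Q F : Type*}
    [TopologicalSpace Q] [ChartedSpace (EuclideanSpace ℝ (Fin 2)) Q] [IsManifold (𝓡 2) ∞ Q]
    [TopologicalSpace F] [ChartedSpace (EuclideanSpace ℝ (Fin n)) F] [IsManifold (𝓡 n) ∞ F]
    (g : PseudoRiemMetric 2 Q) (h : PseudoRiemMetric n F) (r : Q → ℝ)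
    (ψ : OpenPartialHomeomorph Q (EuclideanSpace ℝ (Fin 2)))
    (φ : OpenPartialHomeomorph F (EuclideanSpace ℝ (Fin n)))
    (q : Q) (y : F) : Matrix (Fin n) (Fin n) ℝ :=
  coordEinstein (h.components φ) (φ y)
    - (r q ^ 2 / 2 * coordScal (g.components ψ) (ψ q)) • h.components φ (φ y)
    + (((n : ℝ) - 1) *
        (r q * coordLaplacian (g.components ψ) (r ∘ ψ.symm) (ψ q)
          + ((n : ℝ) - 2) / 2 * coordGradSq (g.components ψ) (r ∘ ψ.symm) (ψ q)))
      • h.components φ (φ y)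

/-- `G_F = lam h` on `Q × F`, as an identity of tensors, i.e. of components in all smooth charts
of `Q` and `F`. -/
def FiberPureTrace {n : ℕ} {Q F : Type*}
    [TopologicalSpace Q] [ChartedSpace (EuclideanSpace ℝ (Fin 2)) Q] [IsManifold (𝓡 2) ∞ Q]
    [TopologicalSpace F] [ChartedSpace (EuclideanSpace ℝ (Fin n)) F] [IsManifold (𝓡 n) ∞ F]
    (g : PseudoRiemMetric 2 Q) (h : PseudoRiemMetric n F) (r : Q → ℝ) (lam : Q × F → ℝ) : Prop :=
  ∀ ψ : OpenPartialHomeomorph Q (EuclideanSpace ℝ (Fin 2)), IsSmoothChart ψ →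
  ∀ φ : OpenPartialHomeomorph F (EuclideanSpace ℝ (Fin n)), IsSmoothChart φ →
  ∀ q ∈ ψ.source, ∀ y ∈ φ.source,
    warpedGF g h r ψ φ q y = lam (q, y) • h.components φ (φ y)

end

/-!
For a fixed `q` the terms of `G_F` that come from `Q` are a number times `h`, so the hypothesis says
that `Einst_h = μ h` with `μ y = lam (q, y) - s` for some real number `s` depending on `q` only.
A single chart around `q` suffices to see this, and its choice does not matter.

If `n = 2`, the curvature `R^{kl}_{ij}`, skew in both pairs of indices, has a single independent
component, which forces `Ric_h = (S_h / 2) h` (`IsCoordMetricOn.coordRicci_two`). The Einstein tensor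
vanishes, and therefore `lam (q, y) = s`.

If `n ≥ 3`, taking the trace turns `Einst_h = μ h` into `Ric_h = f h` with `f = (2 / (2 - n)) μ`, and
Schur's lemma applies: the contracted second Bianchi identity gives `(n - 2) df = 0`
(`IsCoordMetricOn.partialD_eq_zero_of_coordRicci`). So `μ` is locally constant
(`PseudoRiemMetric.isLocallyConstant_of_coordEinstein`), hence constant on the connected fiber, and
so is `f`.

The curvature calculus is carried out in coordinates with matrices. With the connection matrices
`Γ_i = (Γ^k_{il})_{kl}`, put `R_ij = ∂_i Γ_j - ∂_j Γ_i + [Γ_i, Γ_j]` and `P_ij = R_ij G⁻¹`. The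
identities `∂_i G = Γ_iᵀ G + G Γ_i` and `∂_i ∂_j G = ∂_j ∂_i G` make `P_ij` a skew matrix, and the
Bianchi identity is a formal computation in the noncommutative ring of matrices. Symmetry of `Γ` in
its lower indices enters in the contraction, where the connection terms cancel.
-/

noncomputable section

/-! ### Smooth matrix-valued functions and their partial derivatives -/

section Calculus

variable {n : ℕ} {U : Set (EuclideanSpace ℝ (Fin n))} {u : EuclideanSpace ℝ (Fin n)}

theorem ContDiffOn.partialD {f : EuclideanSpace ℝ (Fin n) → ℝ} (hU : IsOpen U)
    (hf : ContDiffOn ℝ ∞ f U) (k : Fin n) : ContDiffOn ℝ ∞ (partialD k f) U := by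
  have h : ContDiffOn ℝ ∞ (fderiv ℝ f) U := hf.fderiv_of_isOpen hU (by simp)
  exact h.clm_apply contDiffOn_const

theorem ContDiffOn.differentiableAt_of_isOpen {f : EuclideanSpace ℝ (Fin n) → ℝ} (hU : IsOpen U)
    (hf : ContDiffOn ℝ ∞ f U) (hu : u ∈ U) : DifferentiableAt ℝ f u :=
  (hf.contDiffAt (hU.mem_nhds hu)).differentiableAt (by simp)

theorem partialD_congr {f g : EuclideanSpace ℝ (Fin n) → ℝ} (hU : IsOpen U)
    (hfg : ∀ w ∈ U, f w = g w) (hu : u ∈ U) (k : Fin n) : partialD k f u = partialD k g u := by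
  have : f =ᶠ[nhds u] g := Filter.eventually_of_mem (hU.mem_nhds hu) hfg
  simp only [partialD, this.fderiv_eq]

theorem partialD_partialD_comm {f : EuclideanSpace ℝ (Fin n) → ℝ} (hU : IsOpen U)
    (hf : ContDiffOn ℝ ∞ f U) (hu : u ∈ U) (i j : Fin n) :
    partialD i (partialD j f) u = partialD j (partialD i f) u := by
  have hfu := hf.contDiffAt (hU.mem_nhds hu)
  have hs : IsSymmSndFDerivAt ℝ f u := hfu.isSymmSndFDerivAt (by
    simp only [minSmoothness_of_isRCLikeNormedField]; exact WithTop.coe_le_coe.2 (le_top (a := (2 : ℕ∞))))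
  have hd : DifferentiableAt ℝ (fderiv ℝ f) u :=
    ((hf.fderiv_of_isOpen hU (m := ∞) (by simp)).contDiffAt (hU.mem_nhds hu)).differentiableAt
      (by simp)
  have key (a b : Fin n) : partialD a (partialD b f) u
      = fderiv ℝ (fderiv ℝ f) u (EuclideanSpace.single a 1) (EuclideanSpace.single b 1) := by
    unfold partialD
    rw [fderiv_clm_apply hd (differentiableAt_const _)]
    simp
  rw [key, key, hs.eq]

/-- A matrix-valued function all of whose entries are smooth on `U`. -/
def SmoothEntriesOn {m : Type*} (A : EuclideanSpace ℝ (Fin n) → Matrix m m ℝ)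
    (U : Set (EuclideanSpace ℝ (Fin n))) : Prop :=
  ∀ i j, ContDiffOn ℝ ∞ (fun u => A u i j) U

/-- The entrywise partial derivative `∂_k A` of a matrix-valued function. -/
def matrixPartialD (k : Fin n) (A : EuclideanSpace ℝ (Fin n) → Matrix (Fin n) (Fin n) ℝ)
    (u : EuclideanSpace ℝ (Fin n)) : Matrix (Fin n) (Fin n) ℝ :=
  Matrix.of fun i j => partialD k (fun w => A w i j) u

variable {A B : EuclideanSpace ℝ (Fin n) → Matrix (Fin n) (Fin n) ℝ}

theorem SmoothEntriesOn.mul (hA : SmoothEntriesOn A U) (hB : SmoothEntriesOn B U) :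
    SmoothEntriesOn (fun u => A u * B u) U := fun i j => by
  simp only [Matrix.mul_apply]
  exact ContDiffOn.sum fun p _ => (hA i p).mul (hB p j)

theorem SmoothEntriesOn.sub (hA : SmoothEntriesOn A U) (hB : SmoothEntriesOn B U) :
    SmoothEntriesOn (fun u => A u - B u) U := fun i j => (hA i j).sub (hB i j)

theorem SmoothEntriesOn.add (hA : SmoothEntriesOn A U) (hB : SmoothEntriesOn B U) :
    SmoothEntriesOn (fun u => A u + B u) U := fun i j => (hA i j).add (hB i j)

theorem SmoothEntriesOn.transpose (hA : SmoothEntriesOn A U) :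
    SmoothEntriesOn (fun u => (A u).transpose) U := fun i j => hA j i

theorem SmoothEntriesOn.matrixPartialD (hU : IsOpen U) (hA : SmoothEntriesOn A U) (k : Fin n) :
    SmoothEntriesOn (matrixPartialD k A) U := fun i j => (hA i j).partialD hU k

theorem SmoothEntriesOn.det {m : Type*} [Fintype m] [DecidableEq m]
    {A : EuclideanSpace ℝ (Fin n) → Matrix m m ℝ} (hA : SmoothEntriesOn A U) :
    ContDiffOn ℝ ∞ (fun u => (A u).det) U := by
  simp only [Matrix.det_apply']
  exact ContDiffOn.sum fun σ _ => contDiffOn_const.mul (contDiffOn_prod fun i _ => hA _ _)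

theorem SmoothEntriesOn.inv (hA : SmoothEntriesOn A U) (hdet : ∀ u ∈ U, (A u).det ≠ 0) :
    SmoothEntriesOn (fun u => (A u)⁻¹) U := fun i j => by
  simp only [Matrix.inv_def, Matrix.smul_apply, Matrix.adjugate_apply, Ring.inverse_eq_inv',
    smul_eq_mul]
  refine (hA.det.inv hdet).mul (SmoothEntriesOn.det fun a b => ?_)
  by_cases h : a = j
  · subst h; simpa using contDiffOn_const
  · simpa [Matrix.updateRow_ne h] using hA a b

theorem matrixPartialD_mul (hU : IsOpen U) (hA : SmoothEntriesOn A U) (hB : SmoothEntriesOn B U)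
    (hu : u ∈ U) (k : Fin n) : matrixPartialD k (fun w => A w * B w) u
      = matrixPartialD k A u * B u + A u * matrixPartialD k B u := by
  ext i j
  simp only [matrixPartialD, partialD, Matrix.of_apply, Matrix.mul_apply, Matrix.add_apply]
  rw [fderiv_fun_sum fun p _ => ((hA i p).differentiableAt_of_isOpen hU hu).fun_mul
    ((hB p j).differentiableAt_of_isOpen hU hu)]
  simp only [sum_apply, ← Finset.sum_add_distrib]
  refine Finset.sum_congr rfl fun p _ => ?_
  rw [fderiv_fun_mul ((hA i p).differentiableAt_of_isOpen hU hu)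
    ((hB p j).differentiableAt_of_isOpen hU hu)]
  simp only [add_apply, smul_apply, smul_eq_mul]
  ring

theorem matrixPartialD_add (hU : IsOpen U) (hA : SmoothEntriesOn A U) (hB : SmoothEntriesOn B U)
    (hu : u ∈ U) (k : Fin n) : matrixPartialD k (fun w => A w + B w) u
      = matrixPartialD k A u + matrixPartialD k B u := by
  ext i j
  simp only [matrixPartialD, partialD, Matrix.of_apply, Matrix.add_apply]
  rw [fderiv_fun_add ((hA i j).differentiableAt_of_isOpen hU hu)
    ((hB i j).differentiableAt_of_isOpen hU hu)]
  rfl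

theorem matrixPartialD_sub (hU : IsOpen U) (hA : SmoothEntriesOn A U) (hB : SmoothEntriesOn B U)
    (hu : u ∈ U) (k : Fin n) : matrixPartialD k (fun w => A w - B w) u
      = matrixPartialD k A u - matrixPartialD k B u := by
  ext i j
  simp only [matrixPartialD, partialD, Matrix.of_apply, Matrix.sub_apply]
  rw [fderiv_fun_sub ((hA i j).differentiableAt_of_isOpen hU hu)
    ((hB i j).differentiableAt_of_isOpen hU hu)]
  rfl

theorem matrixPartialD_transpose (k : Fin n) : matrixPartialD k (fun w => (A w).transpose) u
    = (matrixPartialD k A u).transpose := rfl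

theorem matrixPartialD_congr (hU : IsOpen U) (hAB : ∀ w ∈ U, A w = B w) (hu : u ∈ U) (k : Fin n) :
    matrixPartialD k A u = matrixPartialD k B u := by
  ext i j
  exact partialD_congr hU (fun w hw => by rw [hAB w hw]) hu k

theorem matrixPartialD_const (k : Fin n) (C : Matrix (Fin n) (Fin n) ℝ) :
    matrixPartialD k (fun _ => C) u = 0 := by
  ext i j
  simp [matrixPartialD, partialD]

theorem matrixPartialD_comm (hU : IsOpen U) (hA : SmoothEntriesOn A U) (hu : u ∈ U)
    (i j : Fin n) : matrixPartialD i (matrixPartialD j A) u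
      = matrixPartialD j (matrixPartialD i A) u := by
  ext a b
  exact partialD_partialD_comm hU (hA a b) hu i j

end Calculus

/-! ### The Levi-Civita connection and its curvature as matrix-valued functions -/

section Curvature

variable {n : ℕ} {G : EuclideanSpace ℝ (Fin n) → Matrix (Fin n) (Fin n) ℝ}
  {U : Set (EuclideanSpace ℝ (Fin n))} {u : EuclideanSpace ℝ (Fin n)}

/-- `G` is a smooth pseudo-Riemannian metric on the set `U`, given by its components. -/
structure IsCoordMetricOn (G : EuclideanSpace ℝ (Fin n) → Matrix (Fin n) (Fin n) ℝ)
    (U : Set (EuclideanSpace ℝ (Fin n))) : Prop where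
  isOpen : IsOpen U
  smooth : SmoothEntriesOn G U
  isSymm : ∀ u ∈ U, (G u).IsSymm
  det_ne_zero : ∀ u ∈ U, (G u).det ≠ 0

/-- The connection matrix `Γ_i`, with entry `Γ^k_{il}` in row `k` and column `l`. -/
def connMatrix (G : EuclideanSpace ℝ (Fin n) → Matrix (Fin n) (Fin n) ℝ) (i : Fin n)
    (u : EuclideanSpace ℝ (Fin n)) : Matrix (Fin n) (Fin n) ℝ :=
  Matrix.of fun k l => christoffel G k i l u

/-- The curvature matrix `R_ij = ∂_i Γ_j - ∂_j Γ_i + [Γ_i, Γ_j]`; its entry in row `k` and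
column `l` is the component `R^k_{lij}` of the Riemann tensor. -/
def curvMatrix (G : EuclideanSpace ℝ (Fin n) → Matrix (Fin n) (Fin n) ℝ) (i j : Fin n)
    (u : EuclideanSpace ℝ (Fin n)) : Matrix (Fin n) (Fin n) ℝ :=
  matrixPartialD i (connMatrix G j) u - matrixPartialD j (connMatrix G i) u
    + (connMatrix G i u * connMatrix G j u - connMatrix G j u * connMatrix G i u)

/-- The curvature matrix `P_ij = R_ij G⁻¹` with its second index raised; its entry in row `k` and
column `l` is `R^{kl}_{ij}`. -/
def curvMatrixUp (G : EuclideanSpace ℝ (Fin n) → Matrix (Fin n) (Fin n) ℝ) (i j : Fin n)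
    (u : EuclideanSpace ℝ (Fin n)) : Matrix (Fin n) (Fin n) ℝ :=
  curvMatrix G i j u * (G u)⁻¹

namespace IsCoordMetricOn

theorem inv_mul (hG : IsCoordMetricOn G U) (hu : u ∈ U) : (G u)⁻¹ * G u = 1 :=
  Matrix.nonsing_inv_mul _ (isUnit_iff_ne_zero.2 (hG.det_ne_zero u hu))

theorem mul_inv (hG : IsCoordMetricOn G U) (hu : u ∈ U) : G u * (G u)⁻¹ = 1 :=
  Matrix.mul_nonsing_inv _ (isUnit_iff_ne_zero.2 (hG.det_ne_zero u hu))

theorem smooth_inv (hG : IsCoordMetricOn G U) : SmoothEntriesOn (fun u => (G u)⁻¹) U :=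
  hG.smooth.inv hG.det_ne_zero

theorem inv_transpose (hG : IsCoordMetricOn G U) (hu : u ∈ U) :
    ((G u)⁻¹).transpose = (G u)⁻¹ := by
  rw [Matrix.transpose_nonsing_inv, (hG.isSymm u hu).eq]

theorem smooth_connMatrix (hG : IsCoordMetricOn G U) (i : Fin n) :
    SmoothEntriesOn (connMatrix G i) U := fun k l => by
  have hd (a b c : Fin n) : ContDiffOn ℝ ∞ (partialD a fun w => G w b c) U :=
    (hG.smooth b c).partialD hG.isOpen a
  exact contDiffOn_const.mul (ContDiffOn.sum fun p _ =>
    (hG.smooth_inv k p).mul (((hd _ _ _).add (hd _ _ _)).sub (hd _ _ _)))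

theorem smooth_curvMatrix (hG : IsCoordMetricOn G U) (i j : Fin n) :
    SmoothEntriesOn (curvMatrix G i j) U :=
  (((hG.smooth_connMatrix j).matrixPartialD hG.isOpen i).sub
    ((hG.smooth_connMatrix i).matrixPartialD hG.isOpen j)).add
    (((hG.smooth_connMatrix i).mul (hG.smooth_connMatrix j)).sub
      ((hG.smooth_connMatrix j).mul (hG.smooth_connMatrix i)))

theorem smooth_curvMatrixUp (hG : IsCoordMetricOn G U) (i j : Fin n) :
    SmoothEntriesOn (curvMatrixUp G i j) U :=
  (hG.smooth_curvMatrix i j).mul hG.smooth_inv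

theorem partialD_symm (hG : IsCoordMetricOn G U) (hu : u ∈ U) (k i j : Fin n) :
    partialD k (fun w => G w i j) u = partialD k (fun w => G w j i) u :=
  partialD_congr hG.isOpen (fun w hw => (hG.isSymm w hw).apply j i) hu k

/-- The Levi-Civita connection is torsion-free. -/
theorem christoffel_comm (hG : IsCoordMetricOn G U) (hu : u ∈ U) (k i j : Fin n) :
    christoffel G k i j u = christoffel G k j i u := by
  unfold christoffel
  congr 1
  refine Finset.sum_congr rfl fun l _ => ?_
  rw [hG.partialD_symm hu l i j]
  ring

/-- The Christoffel symbols of the first kind. -/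
theorem mul_connMatrix_apply (hG : IsCoordMetricOn G U) (hu : u ∈ U) (i k l : Fin n) :
    (G u * connMatrix G i u) k l = (1 / 2 : ℝ) * (partialD i (fun w => G w l k) u
      + partialD l (fun w => G w i k) u - partialD k (fun w => G w i l) u) := by
  have h : connMatrix G i u = (G u)⁻¹ * Matrix.of fun p l => (1 / 2 : ℝ) *
      (partialD i (fun w => G w l p) u + partialD l (fun w => G w i p) u
        - partialD p (fun w => G w i l) u) := by
    ext a b
    simp only [connMatrix, christoffel, Matrix.of_apply, Matrix.mul_apply, Finset.mul_sum]
    exact Finset.sum_congr rfl fun p _ => by ring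
  rw [h, ← mul_assoc, hG.mul_inv hu, one_mul, Matrix.of_apply]

/-- The Levi-Civita connection is metric: `∇ G = 0`. -/
theorem matrixPartialD_eq (hG : IsCoordMetricOn G U) (hu : u ∈ U) (i : Fin n) :
    matrixPartialD i G u = (connMatrix G i u).transpose * G u + G u * connMatrix G i u := by
  have ht : (connMatrix G i u).transpose * G u = (G u * connMatrix G i u).transpose := by
    rw [Matrix.transpose_mul, (hG.isSymm u hu).eq]
  ext k l
  rw [ht, Matrix.add_apply, Matrix.transpose_apply, hG.mul_connMatrix_apply hu,
    hG.mul_connMatrix_apply hu, matrixPartialD, Matrix.of_apply, hG.partialD_symm hu i l k]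
  ring

/-- The inverse metric is parallel as well: `∇ G⁻¹ = 0`. -/
theorem matrixPartialD_inv (hG : IsCoordMetricOn G U) (hu : u ∈ U) (i : Fin n) :
    matrixPartialD i (fun w => (G w)⁻¹) u
      = -(connMatrix G i u * (G u)⁻¹ + (G u)⁻¹ * (connMatrix G i u).transpose) := by
  have h1 : matrixPartialD i (fun w => (G w)⁻¹ * G w) u = 0 := by
    rw [matrixPartialD_congr (B := fun _ => 1) hG.isOpen (fun w hw => hG.inv_mul hw) hu,
      matrixPartialD_const]
  rw [matrixPartialD_mul hG.isOpen hG.smooth_inv hG.smooth hu, hG.matrixPartialD_eq hu] at h1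
  have h2 := congrArg (· * (G u)⁻¹) h1
  simp only [add_mul, mul_add, zero_mul] at h2
  rw [mul_assoc, hG.mul_inv hu, mul_one, ← mul_assoc, mul_assoc ((G u)⁻¹ * _), hG.mul_inv hu,
    mul_one, ← mul_assoc, hG.inv_mul hu, one_mul] at h2
  rw [eq_neg_iff_add_eq_zero, ← h2]
  abel

theorem curvMatrix_swap (i j : Fin n) : curvMatrix G j i u = -curvMatrix G i j u := by
  unfold curvMatrix
  abel

theorem curvMatrixUp_swap (i j : Fin n) : curvMatrixUp G j i u = -curvMatrixUp G i j u := by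
  rw [curvMatrixUp, curvMatrix_swap, neg_mul, curvMatrixUp]

/-- The curvature is skew for the metric: applied to the parallel tensor `G`, the commutator of
covariant derivatives `[∇_i, ∇_j]`, which is the left-hand side up to sign, vanishes. -/
theorem curvMatrix_skew (hG : IsCoordMetricOn G U) (hu : u ∈ U) (i j : Fin n) :
    (curvMatrix G i j u).transpose * G u + G u * curvMatrix G i j u = 0 := by
  have key (a b : Fin n) : matrixPartialD a (matrixPartialD b G) u
      = (matrixPartialD a (connMatrix G b) u).transpose * G u
        + (connMatrix G b u).transpose * ((connMatrix G a u).transpose * G u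
          + G u * connMatrix G a u)
        + (((connMatrix G a u).transpose * G u + G u * connMatrix G a u) * connMatrix G b u
        + G u * matrixPartialD a (connMatrix G b) u) := by
    have hb := hG.smooth_connMatrix b
    rw [matrixPartialD_congr hG.isOpen (fun w hw => hG.matrixPartialD_eq hw b) hu,
      matrixPartialD_add hG.isOpen (hb.transpose.mul hG.smooth) (hG.smooth.mul hb) hu,
      matrixPartialD_mul hG.isOpen hb.transpose hG.smooth hu,
      matrixPartialD_mul hG.isOpen hG.smooth hb hu, matrixPartialD_transpose,
      hG.matrixPartialD_eq hu]
  have h := matrixPartialD_comm hG.isOpen hG.smooth hu i j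
  rw [key, key, ← sub_eq_zero] at h
  rw [← h]
  simp only [curvMatrix, Matrix.transpose_add, Matrix.transpose_sub, Matrix.transpose_mul]
  noncomm_ring

theorem curvMatrixUp_transpose (hG : IsCoordMetricOn G U) (hu : u ∈ U) (i j : Fin n) :
    (curvMatrixUp G i j u).transpose = -curvMatrixUp G i j u := by
  rw [curvMatrixUp, Matrix.transpose_mul, hG.inv_transpose hu, eq_neg_iff_add_eq_zero]
  have h := congrArg (fun X => (G u)⁻¹ * X * (G u)⁻¹) (hG.curvMatrix_skew hu i j)
  simp only [mul_add, add_mul, mul_zero, zero_mul] at h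
  rwa [← mul_assoc, mul_assoc _ (G u), hG.mul_inv hu, mul_one, ← mul_assoc, hG.inv_mul hu,
    one_mul] at h

theorem curvMatrixUp_apply_swap (hG : IsCoordMetricOn G U) (hu : u ∈ U) (i j k l : Fin n) :
    curvMatrixUp G i j u l k = -curvMatrixUp G i j u k l := by
  have := congrFun (congrFun (hG.curvMatrixUp_transpose hu i j) k) l
  simpa using this

theorem matrixPartialD_curvMatrix (hG : IsCoordMetricOn G U) (hu : u ∈ U) (m i j : Fin n) :
    matrixPartialD m (curvMatrix G i j) u
      = matrixPartialD m (matrixPartialD i (connMatrix G j)) u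
        - matrixPartialD m (matrixPartialD j (connMatrix G i)) u
        + (matrixPartialD m (connMatrix G i) u * connMatrix G j u
          + connMatrix G i u * matrixPartialD m (connMatrix G j) u
          - (matrixPartialD m (connMatrix G j) u * connMatrix G i u
          + connMatrix G j u * matrixPartialD m (connMatrix G i) u)) := by
  have hi := hG.smooth_connMatrix i
  have hj := hG.smooth_connMatrix j
  have hij := hj.matrixPartialD hG.isOpen i
  have hji := hi.matrixPartialD hG.isOpen j
  unfold curvMatrix
  rw [matrixPartialD_add hG.isOpen (hij.sub hji) ((hi.mul hj).sub (hj.mul hi)) hu,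
    matrixPartialD_sub hG.isOpen hij hji hu,
    matrixPartialD_sub hG.isOpen (hi.mul hj) (hj.mul hi) hu,
    matrixPartialD_mul hG.isOpen hi hj hu, matrixPartialD_mul hG.isOpen hj hi hu]

/-- The second Bianchi identity for the mixed curvature. The form indices `i j m` are differentiated
without connection terms, since by symmetry of `Γ` these cancel in the cyclic sum. -/
theorem bianchi_curvMatrix (hG : IsCoordMetricOn G U) (hu : u ∈ U) (i j m : Fin n) :
    (matrixPartialD i (curvMatrix G j m) u
        + (connMatrix G i u * curvMatrix G j m u - curvMatrix G j m u * connMatrix G i u))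
      + (matrixPartialD j (curvMatrix G m i) u
        + (connMatrix G j u * curvMatrix G m i u - curvMatrix G m i u * connMatrix G j u))
      + (matrixPartialD m (curvMatrix G i j) u
        + (connMatrix G m u * curvMatrix G i j u - curvMatrix G i j u * connMatrix G m u))
      = 0 := by
  rw [hG.matrixPartialD_curvMatrix hu, hG.matrixPartialD_curvMatrix hu,
    hG.matrixPartialD_curvMatrix hu,
    matrixPartialD_comm hG.isOpen (hG.smooth_connMatrix m) hu i j,
    matrixPartialD_comm hG.isOpen (hG.smooth_connMatrix j) hu i m,
    matrixPartialD_comm hG.isOpen (hG.smooth_connMatrix i) hu j m]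
  unfold curvMatrix
  noncomm_ring

/-- Raising an index commutes with the covariant derivative. -/
theorem covariant_curvMatrixUp (hG : IsCoordMetricOn G U) (hu : u ∈ U) (i j m : Fin n) :
    matrixPartialD i (curvMatrixUp G j m) u + connMatrix G i u * curvMatrixUp G j m u
        + curvMatrixUp G j m u * (connMatrix G i u).transpose
      = (matrixPartialD i (curvMatrix G j m) u + (connMatrix G i u * curvMatrix G j m u
        - curvMatrix G j m u * connMatrix G i u)) * (G u)⁻¹ := by
  unfold curvMatrixUp
  rw [matrixPartialD_mul hG.isOpen (hG.smooth_curvMatrix j m) hG.smooth_inv hu,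
    hG.matrixPartialD_inv hu]
  noncomm_ring

/-- The second Bianchi identity for the curvature `R^{kl}_{ij}`. -/
theorem bianchi_curvMatrixUp (hG : IsCoordMetricOn G U) (hu : u ∈ U) (i j m : Fin n) :
    (matrixPartialD i (curvMatrixUp G j m) u + connMatrix G i u * curvMatrixUp G j m u
        + curvMatrixUp G j m u * (connMatrix G i u).transpose)
      + (matrixPartialD j (curvMatrixUp G m i) u + connMatrix G j u * curvMatrixUp G m i u
        + curvMatrixUp G m i u * (connMatrix G j u).transpose)
      + (matrixPartialD m (curvMatrixUp G i j) u + connMatrix G m u * curvMatrixUp G i j u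
        + curvMatrixUp G i j u * (connMatrix G m u).transpose) = 0 := by
  rw [hG.covariant_curvMatrixUp hu, hG.covariant_curvMatrixUp hu, hG.covariant_curvMatrixUp hu,
    ← add_mul, ← add_mul, hG.bianchi_curvMatrix hu, zero_mul]

/-- The Ricci tensor is the trace `R_{pj} = R^k_{pkj}` of the curvature. -/
theorem coordRicci_eq_sum (hG : IsCoordMetricOn G U) (hu : u ∈ U) (p j : Fin n) :
    coordRicci G u p j = ∑ k, curvMatrix G k j u k p := by
  simp only [coordRicci, Matrix.of_apply, ← Finset.sum_add_distrib]
  refine Finset.sum_congr rfl fun k _ => ?_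
  simp only [curvMatrix, matrixPartialD, connMatrix, Matrix.add_apply, Matrix.sub_apply,
    Matrix.of_apply, Matrix.mul_apply, ← Finset.sum_sub_distrib]
  congr 1
  · rw [partialD_congr hG.isOpen (fun w hw => hG.christoffel_comm hw k p j) hu,
      partialD_congr hG.isOpen (fun w hw => hG.christoffel_comm hw k p k) hu]
  · refine Finset.sum_congr rfl fun l _ => ?_
    rw [hG.christoffel_comm hu l p j, hG.christoffel_comm hu l p k]

/-- The Ricci tensor with an index raised, `R^l_j = R^{kl}_{kj}`. -/
theorem sum_curvMatrixUp (hG : IsCoordMetricOn G U) (hu : u ∈ U) (j l : Fin n) :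
    ∑ k, curvMatrixUp G k j u k l = ((coordRicci G u).transpose * (G u)⁻¹) j l := by
  simp only [curvMatrixUp, Matrix.mul_apply, Matrix.transpose_apply, hG.coordRicci_eq_sum hu,
    Finset.sum_mul]
  exact Finset.sum_comm

/-- In dimension two `Ric = s G`, where `s = R^{01}_{01}`. -/
theorem coordRicci_two {G : EuclideanSpace ℝ (Fin 2) → Matrix (Fin 2) (Fin 2) ℝ}
    {U : Set (EuclideanSpace ℝ (Fin 2))} {u : EuclideanSpace ℝ (Fin 2)}
    (hG : IsCoordMetricOn G U) (hu : u ∈ U) :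
    coordRicci G u = curvMatrixUp G 0 1 u 0 1 • G u := by
  have hself (i : Fin 2) : curvMatrixUp G i i u = 0 := by
    ext k l
    exact self_eq_neg.1 (congrFun (congrFun (curvMatrixUp_swap i i) k) l)
  have hdiag (i j k : Fin 2) : curvMatrixUp G i j u k k = 0 :=
    self_eq_neg.1 (hG.curvMatrixUp_apply_swap hu i j k k)
  have h : (coordRicci G u).transpose * (G u)⁻¹
      = curvMatrixUp G 0 1 u 0 1 • (1 : Matrix (Fin 2) (Fin 2) ℝ) := by
    ext j l
    rw [← hG.sum_curvMatrixUp hu, Fin.sum_univ_two]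
    fin_cases j <;> fin_cases l <;>
      simp [hself, hdiag, curvMatrixUp_swap 0 1, hG.curvMatrixUp_apply_swap hu 0 1 0 1]
  have h2 := congrArg (· * G u) h
  simp only [smul_mul_assoc, one_mul] at h2
  rw [mul_assoc, hG.inv_mul hu, mul_one] at h2
  rw [← Matrix.transpose_transpose (coordRicci G u), h2, Matrix.transpose_smul,
    (hG.isSymm u hu).eq]

theorem coordScal_of_coordRicci_eq_smul (hG : IsCoordMetricOn G U) (hu : u ∈ U) {c : ℝ}
    (h : coordRicci G u = c • G u) : coordScal G u = n * c := by
  have : coordScal G u = ((G u)⁻¹ * (coordRicci G u).transpose).trace := by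
    simp [coordScal, Matrix.trace, Matrix.mul_apply]
  rw [this, h, Matrix.transpose_smul, (hG.isSymm u hu).eq, mul_smul_comm, hG.inv_mul hu]
  simp [mul_comm]

/-- The Einstein tensor of a surface vanishes. -/
theorem coordEinstein_two {G : EuclideanSpace ℝ (Fin 2) → Matrix (Fin 2) (Fin 2) ℝ}
    {U : Set (EuclideanSpace ℝ (Fin 2))} {u : EuclideanSpace ℝ (Fin 2)}
    (hG : IsCoordMetricOn G U) (hu : u ∈ U) : coordEinstein G u = 0 := by
  rw [coordEinstein, hG.coordScal_of_coordRicci_eq_smul hu (hG.coordRicci_two hu),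
    hG.coordRicci_two hu, ← sub_smul]
  convert zero_smul ℝ (G u) using 2
  push_cast
  ring

/-- The trace part of a pure trace Ricci tensor is smooth, being a contraction of the curvature. -/
theorem contDiffOn_of_coordRicci (hG : IsCoordMetricOn G U) {f : EuclideanSpace ℝ (Fin n) → ℝ}
    (hf : ∀ w ∈ U, coordRicci G w = f w • G w) (j : Fin n) : ContDiffOn ℝ ∞ f U := by
  have h : ContDiffOn ℝ ∞ (fun w => ∑ k, curvMatrixUp G k j w k j) U :=
    ContDiffOn.sum fun k _ => hG.smooth_curvMatrixUp k j k j
  refine h.congr fun w hw => ?_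
  rw [hG.sum_curvMatrixUp hw, hf w hw, Matrix.transpose_smul, (hG.isSymm w hw).eq,
    smul_mul_assoc, hG.mul_inv hw]
  simp

theorem sum_sum_mul_eq_zero {ι : Type*} [Fintype ι] {a b : ι → ι → ℝ} (ha : ∀ i j, a j i = -a i j)
    (hb : ∀ i j, b j i = b i j) : ∑ i, ∑ j, a i j * b i j = 0 := by
  refine self_eq_neg.1 ?_
  rw [← Finset.sum_neg_distrib, Finset.sum_comm]
  refine Finset.sum_congr rfl fun i _ => ?_
  rw [← Finset.sum_neg_distrib]
  exact Finset.sum_congr rfl fun j _ => by rw [ha i j, hb i j, neg_mul]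

/-- Schur's lemma in coordinates. The Bianchi identity for `R^{kl}_{ij}`, contracted over `i = k` and
`j = l`, reads `(n - 2) ∂_m f = 0` when the Ricci tensor is `f G`. -/
theorem partialD_eq_zero_of_coordRicci (hG : IsCoordMetricOn G U) {f : EuclideanSpace ℝ (Fin n) → ℝ}
    (hf : ∀ w ∈ U, coordRicci G w = f w • G w) (hn : 3 ≤ n) (hu : u ∈ U) (m : Fin n) :
    partialD m f u = 0 := by
  have hE (w) (hw : w ∈ U) (j l : Fin n) :
      ∑ k, curvMatrixUp G k j w k l = if j = l then f w else 0 := by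
    rw [hG.sum_curvMatrixUp hw, hf w hw, Matrix.transpose_smul, (hG.isSymm w hw).eq,
      smul_mul_assoc, hG.mul_inv hw]
    simp [Matrix.one_apply]
  -- The same contraction with the pair of upper, of lower, or both pairs of indices swapped.
  have hE_up (w) (hw : w ∈ U) (j l : Fin n) :
      ∑ k, curvMatrixUp G k j w l k = if j = l then -f w else 0 := by
    simp only [fun k => hG.curvMatrixUp_apply_swap hw k j k l, Finset.sum_neg_distrib, hE w hw]
    split_ifs <;> simp
  have hE_low (w) (hw : w ∈ U) (j l : Fin n) :
      ∑ k, curvMatrixUp G j k w k l = if j = l then -f w else 0 := by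
    simp only [fun k => curvMatrixUp_swap (G := G) (u := w) k j, Matrix.neg_apply,
      Finset.sum_neg_distrib, hE w hw]
    split_ifs <;> simp
  have hE_both (w) (hw : w ∈ U) (j l : Fin n) :
      ∑ k, curvMatrixUp G j k w l k = if j = l then f w else 0 := by
    simp only [fun k => curvMatrixUp_swap (G := G) (u := w) k j, Matrix.neg_apply,
      Finset.sum_neg_distrib, hE_up w hw]
    split_ifs <;> simp
  have hsum (a : Fin n) (F : Fin n → EuclideanSpace ℝ (Fin n) → ℝ)
      (hF : ∀ k, ContDiffOn ℝ ∞ (F k) U) :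
      ∑ k, partialD a (F k) u = partialD a (fun w => ∑ k, F k w) u := by
    simp only [partialD]
    rw [fderiv_fun_sum fun k _ => (hF k).differentiableAt_of_isOpen hG.isOpen hu]
    simp
  have hneg (a b : Fin n) : partialD a (fun w => if m = b then -f w else 0) u
      = if m = b then -partialD a f u else 0 := by
    split_ifs <;> simp [partialD]
  -- The derivative terms of the contracted Bianchi identity.
  have hd1 : ∑ k, ∑ l, partialD k (fun w => curvMatrixUp G l m w k l) u = -partialD m f u := by
    simp only [fun k => hsum k (fun l w => curvMatrixUp G l m w k l)
      (fun l => hG.smooth_curvMatrixUp _ _ _ _),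
      fun k => partialD_congr hG.isOpen (fun w hw => hE_up w hw m k) hu k, hneg]
    simp
  have hd2 : ∑ k, ∑ l, partialD l (fun w => curvMatrixUp G m k w k l) u = -partialD m f u := by
    rw [Finset.sum_comm]
    simp only [fun l => hsum l (fun k w => curvMatrixUp G m k w k l)
      (fun k => hG.smooth_curvMatrixUp _ _ _ _),
      fun l => partialD_congr hG.isOpen (fun w hw => hE_low w hw m l) hu l, hneg]
    simp
  have hd3 : ∑ k, ∑ l, partialD m (fun w => curvMatrixUp G k l w k l) u = n * partialD m f u := by
    rw [Finset.sum_comm]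
    simp only [fun l => hsum m (fun k w => curvMatrixUp G k l w k l)
      (fun k => hG.smooth_curvMatrixUp _ _ _ _),
      fun l => partialD_congr hG.isOpen (fun w hw => hE w hw l l) hu m]
    simp
  -- The connection terms: in `h2` and `h3` a skew pair of indices meets a symmetric one, and the
  -- other four cancel in pairs.
  have h1 : ∑ k, ∑ l, ∑ p, christoffel G k k p u * curvMatrixUp G l m u p l
      = -f u * ∑ k, christoffel G k k m u := by
    rw [Finset.mul_sum]
    refine Finset.sum_congr rfl fun k _ => ?_
    rw [Finset.sum_comm]
    simp only [← Finset.mul_sum, hE_up u hu]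
    simp [mul_comm]
  have h2 : ∑ k, ∑ l, ∑ p, curvMatrixUp G l m u k p * christoffel G l k p u = 0 := by
    rw [Finset.sum_comm]
    exact Finset.sum_eq_zero fun l _ => sum_sum_mul_eq_zero
      (fun _ _ => hG.curvMatrixUp_apply_swap hu _ _ _ _) fun _ _ => hG.christoffel_comm hu _ _ _
  have h3 : ∑ k, ∑ l, ∑ p, christoffel G k l p u * curvMatrixUp G m k u p l = 0 := by
    refine Finset.sum_eq_zero fun k _ => ?_
    simp only [mul_comm (christoffel G k _ _ u)]
    exact sum_sum_mul_eq_zero (a := fun l p => curvMatrixUp G m k u p l)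
      (fun _ _ => hG.curvMatrixUp_apply_swap hu _ _ _ _) fun _ _ => hG.christoffel_comm hu _ _ _
  have h4 : ∑ k, ∑ l, ∑ p, curvMatrixUp G m k u k p * christoffel G l l p u
      = -f u * ∑ k, christoffel G k k m u := by
    rw [Finset.sum_comm, Finset.mul_sum]
    refine Finset.sum_congr rfl fun l _ => ?_
    rw [Finset.sum_comm]
    simp only [← Finset.sum_mul, hE_low u hu]
    simp
  have h5 : ∑ k, ∑ l, ∑ p, christoffel G k m p u * curvMatrixUp G k l u p l
      = f u * ∑ k, christoffel G k k m u := by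
    rw [Finset.mul_sum]
    refine Finset.sum_congr rfl fun k _ => ?_
    rw [Finset.sum_comm]
    simp only [← Finset.mul_sum, hE_both u hu, hG.christoffel_comm hu k k m]
    simp [mul_comm]
  have h6 : ∑ k, ∑ l, ∑ p, curvMatrixUp G k l u k p * christoffel G l m p u
      = f u * ∑ k, christoffel G k k m u := by
    rw [Finset.sum_comm, Finset.mul_sum]
    refine Finset.sum_congr rfl fun l _ => ?_
    rw [Finset.sum_comm]
    simp only [← Finset.sum_mul, hE u hu, hG.christoffel_comm hu l l m]
    simp
  have hB : ∑ k, ∑ l, ((matrixPartialD k (curvMatrixUp G l m) u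
        + connMatrix G k u * curvMatrixUp G l m u
        + curvMatrixUp G l m u * (connMatrix G k u).transpose)
      + (matrixPartialD l (curvMatrixUp G m k) u + connMatrix G l u * curvMatrixUp G m k u
        + curvMatrixUp G m k u * (connMatrix G l u).transpose)
      + (matrixPartialD m (curvMatrixUp G k l) u + connMatrix G m u * curvMatrixUp G k l u
        + curvMatrixUp G k l u * (connMatrix G m u).transpose)) k l = 0 :=
    Finset.sum_eq_zero fun k _ => Finset.sum_eq_zero fun l _ => by
      rw [hG.bianchi_curvMatrixUp hu, Matrix.zero_apply]
  simp only [Matrix.add_apply, Matrix.mul_apply, Matrix.transpose_apply, matrixPartialD,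
    connMatrix, Matrix.of_apply, Finset.sum_add_distrib] at hB
  rw [hd1, hd2, hd3, h1, h2, h3, h4, h5, h6] at hB
  have hn' : (3 : ℝ) ≤ n := mod_cast hn
  have : ((n : ℝ) - 2) * partialD m f u = 0 := by linarith
  exact (mul_eq_zero.1 this).resolve_left (by linarith)

end IsCoordMetricOn

end Curvature

/-! ### Components of a metric in a chart -/

section Components

variable {n : ℕ} {M : Type*} [TopologicalSpace M] [ChartedSpace (EuclideanSpace ℝ (Fin n)) M]
  {φ : OpenPartialHomeomorph M (EuclideanSpace ℝ (Fin n))}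

theorem IsSmoothChart.contMDiffAt_symm (hφ : IsSmoothChart φ) {u : EuclideanSpace ℝ (Fin n)}
    (hu : u ∈ φ.target) : ContMDiffAt (𝓡 n) (𝓡 n) ∞ φ.symm u :=
  contMDiffAt_symm_of_mem_maximalAtlas hφ hu

theorem IsSmoothChart.mdifferentiable (hφ : IsSmoothChart φ) : φ.MDifferentiable (𝓡 n) (𝓡 n) :=
  ⟨(contMDiffOn_of_mem_maximalAtlas hφ).mdifferentiableOn (by simp),
    (contMDiffOn_symm_of_mem_maximalAtlas hφ).mdifferentiableOn (by simp)⟩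

variable [IsManifold (𝓡 n) ∞ M]

/-- The coordinate vector fields are smooth, as sections along the inverse of the chart. -/
theorem IsSmoothChart.contMDiffAt_coordVector (hφ : IsSmoothChart φ)
    {u : EuclideanSpace ℝ (Fin n)} (hu : u ∈ φ.target) (i : Fin n) :
    ContMDiffAt (𝓡 n) ((𝓡 n).prod (𝓡 n)) ∞
      (fun w => Bundle.TotalSpace.mk' (EuclideanSpace ℝ (Fin n))
        (E := (TangentSpace (𝓡 n) : M → Type _)) (φ.symm w) (coordVector φ i w)) u := by
  have h1 := (hφ.contMDiffAt_symm hu).mfderiv_const (m := ∞) (by simp)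
  have h2 : ContMDiffAt (𝓡 n) ((𝓡 n).prod (𝓡 n)) ∞
      (fun w : EuclideanSpace ℝ (Fin n) => Bundle.TotalSpace.mk' (EuclideanSpace ℝ (Fin n))
        (E := (TangentSpace (𝓡 n) : EuclideanSpace ℝ (Fin n) → Type _)) w
        (show TangentSpace (𝓡 n) w from EuclideanSpace.single i (1 : ℝ))) u :=
    contMDiffAt_vectorSpace_iff_contDiffAt.2 contDiffAt_const
  exact ContMDiffAt.clm_apply_of_inCoordinates (b₁ := fun w => w) h1 h2 (hφ.contMDiffAt_symm hu)

theorem PseudoRiemMetric.contDiffOn_components (g : PseudoRiemMetric n M) (hφ : IsSmoothChart φ)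
    (i j : Fin n) : ContDiffOn ℝ ∞ (fun u => g.components φ u i j) φ.target := by
  intro u hu
  refine ContDiffAt.contDiffWithinAt (contMDiffAt_iff_contDiffAt.1 ?_)
  have h1 := (g.contMDiff (φ.symm u)).comp u (hφ.contMDiffAt_symm hu)
  have h : ContMDiffAt (𝓡 n) ((𝓡 n).prod 𝓘(ℝ, ℝ)) ∞
      (fun w => Bundle.TotalSpace.mk' ℝ (E := Bundle.Trivial M ℝ) (φ.symm w)
        (g.toForm (φ.symm w) (coordVector φ i w) (coordVector φ j w))) u :=
    ContMDiffAt.clm_bundle_apply₂ (F₁ := EuclideanSpace ℝ (Fin n))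
      (F₂ := EuclideanSpace ℝ (Fin n)) h1 (hφ.contMDiffAt_coordVector hu i)
      (hφ.contMDiffAt_coordVector hu j)
  rw [Bundle.contMDiffAt_totalSpace] at h
  exact h.2

/-- A vector in the kernel of the component matrix gives, through the coordinate frame, a tangent
vector orthogonal to everything. -/
theorem PseudoRiemMetric.det_components_ne_zero (g : PseudoRiemMetric n M) (hφ : IsSmoothChart φ)
    {u : EuclideanSpace ℝ (Fin n)} (hu : u ∈ φ.target) : (g.components φ u).det ≠ 0 := by
  have hbij := hφ.mdifferentiable.symm.mfderiv_bijective (x := u) hu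
  set D := mfderiv (𝓡 n) (𝓡 n) φ.symm u
  rw [Ne, ← Matrix.exists_mulVec_eq_zero_iff]
  rintro ⟨c, hc0, hc⟩
  apply hc0
  have hsum (b : Fin n → ℝ) :
      D (show TangentSpace (𝓡 n) u from WithLp.toLp 2 b) = ∑ j, b j • coordVector φ j u := by
    have : (WithLp.toLp 2 b : EuclideanSpace ℝ (Fin n))
        = ∑ j, b j • EuclideanSpace.single j (1 : ℝ) := by
      ext k
      simp [Finset.sum_apply, Pi.single_apply]
    rw [this]
    exact (map_sum D _ _).trans (Finset.sum_congr rfl fun j _ => map_smul D _ _)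
  have hzero : ∑ j, c j • coordVector φ j u = 0 := by
    refine g.nondegenerate _ _ fun w => ?_
    obtain ⟨v, rfl⟩ := hbij.2 w
    have hv := hsum (WithLp.ofLp (show EuclideanSpace ℝ (Fin n) from v))
    change D v = _ at hv
    rw [hv, map_sum]
    refine Finset.sum_eq_zero fun i _ => ?_
    rw [map_smul, g.symm]
    have := congrFun hc i
    simp only [Matrix.mulVec, dotProduct, PseudoRiemMetric.components, Matrix.of_apply] at this
    rw [map_sum]
    simp only [map_smul, smul_eq_mul]
    simp only [mul_comm (c _)]
    exact mul_eq_zero_of_right _ this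
  rw [← hsum] at hzero
  have := hbij.1 (hzero.trans (map_zero D).symm)
  exact congrArg WithLp.ofLp this

theorem PseudoRiemMetric.isCoordMetricOn_components (g : PseudoRiemMetric n M)
    (hφ : IsSmoothChart φ) : IsCoordMetricOn (g.components φ) φ.target where
  isOpen := φ.open_target
  smooth := g.contDiffOn_components hφ
  isSymm _ _ := Matrix.IsSymm.ext fun _ _ => g.symm _ _ _
  det_ne_zero _ := g.det_components_ne_zero hφ

end Components

/-! ### Schur's lemma and the fiber part of the Einstein tensor -/

theorem fderiv_eq_zero_of_partialD {n : ℕ} {f : EuclideanSpace ℝ (Fin n) → ℝ}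
    {u : EuclideanSpace ℝ (Fin n)} (h : ∀ m, partialD m f u = 0) : fderiv ℝ f u = 0 := by
  refine ContinuousLinearMap.coe_injective
    ((EuclideanSpace.basisFun (Fin n) ℝ).toBasis.ext fun m => ?_)
  simpa [partialD] using h m

/-- If `Einst = μ G` then `Ric = (2 / (2 - n)) μ G`. -/
theorem IsCoordMetricOn.coordRicci_of_coordEinstein {n : ℕ}
    {G : EuclideanSpace ℝ (Fin n) → Matrix (Fin n) (Fin n) ℝ} {U : Set (EuclideanSpace ℝ (Fin n))}
    {u : EuclideanSpace ℝ (Fin n)} (hG : IsCoordMetricOn G U) (hu : u ∈ U) (hn : 3 ≤ n) {μ : ℝ}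
    (h : coordEinstein G u = μ • G u) : coordRicci G u = (2 / (2 - n) * μ) • G u := by
  have hR : coordRicci G u = (μ + 1 / 2 * coordScal G u) • G u := by
    rw [add_smul, ← h, coordEinstein, sub_add_cancel]
  have hS := hG.coordScal_of_coordRicci_eq_smul hu hR
  have hn' : (2 - n : ℝ) ≠ 0 := by
    have : (3 : ℝ) ≤ n := mod_cast hn
    linarith
  rw [hR]
  congr 1
  field_simp
  linear_combination 2 * hS

/-- Schur's lemma for the Einstein tensor: if it is `μ` times the metric in every chart, then `μ`
is locally constant. -/
theorem PseudoRiemMetric.isLocallyConstant_of_coordEinstein {n : ℕ} (hn : 3 ≤ n) {M : Type*}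
    [TopologicalSpace M] [ChartedSpace (EuclideanSpace ℝ (Fin n)) M] [IsManifold (𝓡 n) ∞ M]
    (h : PseudoRiemMetric n M) {μ : M → ℝ}
    (hE : ∀ φ : OpenPartialHomeomorph M (EuclideanSpace ℝ (Fin n)), IsSmoothChart φ →
      ∀ x ∈ φ.source, coordEinstein (h.components φ) (φ x) = μ x • h.components φ (φ x)) :
    IsLocallyConstant μ := by
  have hn' : (2 / (2 - n) : ℝ) ≠ 0 := by
    have : (3 : ℝ) ≤ n := mod_cast hn
    exact div_ne_zero two_ne_zero (by linarith)
  rw [IsLocallyConstant.iff_exists_open]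
  intro x
  set φ := chartAt (EuclideanSpace ℝ (Fin n)) x
  have hφ : IsSmoothChart φ := IsManifold.chart_mem_maximalAtlas x
  have hx : x ∈ φ.source := mem_chart_source _ x
  have hG := h.isCoordMetricOn_components hφ
  let f : EuclideanSpace ℝ (Fin n) → ℝ := fun u => 2 / (2 - n) * μ (φ.symm u)
  have hf : ∀ u ∈ φ.target, coordRicci (h.components φ) u = f u • h.components φ u := by
    intro u hu
    refine hG.coordRicci_of_coordEinstein hu hn ?_
    have := hE φ hφ (φ.symm u) (φ.map_target hu)
    rwa [φ.right_inv hu] at this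
  -- Vanishing partial derivatives carry information only because `f` is known to be smooth.
  have hsm := hG.contDiffOn_of_coordRicci hf ⟨0, by omega⟩
  have hopen := φ.open_target.isOpen_inter_preimage_of_fderiv_eq_zero
    (hsm.differentiableOn (by simp))
    (fun u hu => fderiv_eq_zero_of_partialD fun m => hG.partialD_eq_zero_of_coordRicci hf hn hu m)
    {f (φ x)}
  refine ⟨φ.source ∩ φ ⁻¹' (φ.target ∩ f ⁻¹' {f (φ x)}), φ.isOpen_inter_preimage hopen,
    ⟨hx, φ.map_source hx, rfl⟩, fun y hy => ?_⟩
  have := hy.2.2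
  simp only [f, Set.mem_preimage, Set.mem_singleton_iff, φ.left_inv hy.1, φ.left_inv hx] at this
  exact mul_left_cancel₀ hn' this

theorem lemma3p1 {n : ℕ} (hn : 2 ≤ n) {Q F : Type*}
    [TopologicalSpace Q] [ChartedSpace (EuclideanSpace ℝ (Fin 2)) Q] [IsManifold (𝓡 2) ∞ Q]
    [Nonempty Q]
    [TopologicalSpace F] [ChartedSpace (EuclideanSpace ℝ (Fin n)) F] [IsManifold (𝓡 n) ∞ F]
    (hF : 3 ≤ n → PreconnectedSpace F)
    (g : PseudoRiemMetric 2 Q) (h : PseudoRiemMetric n F)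
    (r : Q → ℝ) (hr : ContMDiff (𝓡 2) 𝓘(ℝ, ℝ) ∞ r) (hrpos : ∀ q, 0 < r q)
    (lam : Q × F → ℝ) (hG : FiberPureTrace g h r lam) :
    (∀ (q : Q) (y y' : F), lam (q, y) = lam (q, y')) ∧
      (3 ≤ n → h.IsEinstein) := by
  -- At a fixed point `q` the terms coming from `Q` are a constant multiple of the metric of `F`.
  have hEin (q : Q) : ∃ s : ℝ, ∀ φ : OpenPartialHomeomorph F (EuclideanSpace ℝ (Fin n)),
      IsSmoothChart φ → ∀ y ∈ φ.source,
      coordEinstein (h.components φ) (φ y) = (lam (q, y) - s) • h.components φ (φ y) := by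
    let ψ := chartAt (EuclideanSpace ℝ (Fin 2)) q
    refine ⟨((n : ℝ) - 1) *
        (r q * coordLaplacian (g.components ψ) (r ∘ ψ.symm) (ψ q)
          + ((n : ℝ) - 2) / 2 * coordGradSq (g.components ψ) (r ∘ ψ.symm) (ψ q))
        - r q ^ 2 / 2 * coordScal (g.components ψ) (ψ q), fun φ hφ y hy => ?_⟩
    have := hG ψ (IsManifold.chart_mem_maximalAtlas q) φ hφ q (mem_chart_source _ q) y hy
    rw [sub_smul, sub_smul, ← this, warpedGF]
    abel
  have hconst (hn3 : 3 ≤ n) (q : Q) (y y' : F) : lam (q, y) = lam (q, y') := by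
    have := hF hn3
    obtain ⟨s, hs⟩ := hEin q
    have := (h.isLocallyConstant_of_coordEinstein hn3 hs).apply_eq_of_isPreconnected
      isPreconnected_univ (Set.mem_univ y) (Set.mem_univ y')
    linarith
  refine ⟨?_, fun hn3 => ?_⟩
  · obtain rfl | hn3 : n = 2 ∨ 3 ≤ n := by omega
    · intro q
      obtain ⟨s, hs⟩ := hEin q
      have key (y : F) : lam (q, y) = s := by
        have hφ : IsSmoothChart (chartAt (EuclideanSpace ℝ (Fin 2)) y) :=
          IsManifold.chart_mem_maximalAtlas y
        have hy := mem_chart_source (EuclideanSpace ℝ (Fin 2)) y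
        have hc := h.isCoordMetricOn_components hφ
        have hu := (chartAt (EuclideanSpace ℝ (Fin 2)) y).map_source hy
        have h0 := hs _ hφ y hy
        rw [hc.coordEinstein_two hu, eq_comm, smul_eq_zero] at h0
        refine sub_eq_zero.1 (h0.resolve_right fun hz => hc.det_ne_zero _ hu ?_)
        rw [hz, Matrix.det_zero]
      exact fun y y' => (key y).trans (key y').symm
    · exact hconst hn3
  · obtain ⟨q⟩ := ‹Nonempty Q›
    obtain ⟨s, hs⟩ := hEin q
    rcases isEmpty_or_nonempty F with hemp | ⟨⟨y₀⟩⟩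
    · -- On an empty fiber the Einstein condition is vacuous.
      exact ⟨0, fun φ _ x => isEmptyElim x⟩
    · refine ⟨2 / (2 - n) * (lam (q, y₀) - s), fun φ hφ x hx => ?_⟩
      refine (h.isCoordMetricOn_components hφ).coordRicci_of_coordEinstein (φ.map_source hx) hn3 ?_
      rw [hs φ hφ x hx, hconst hn3 q x y₀]

end
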